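/- Let $1\le k\le n$ be integers, let $\mathcal Y=\{1,\dots,n\}$, let $\Delta_{\mathcal Y}$ be the set of probability distributions on $\mathcal Y$, and let $\mathcal R_k$ be the set of subsets of $\mathcal Y$ of size exactly $k$. For $u\in\mathbb R^n$ let $u_{[i]}$ be the $i$-th largest entry of $u$, let $e_y$ be the $y$-th standard basis vector, and let $[x]_+=\max(x,0)$. The top-$k$ loss is $\ell_k(S,y)=\mathbb 1\{y\notin S\}$ for $S\in\mathcal R_k$, and $$L_3(u,y)=\frac1k\sum_{i=1}^k\bigl[\,1-u_y+(u-e_y)_{[i]}\,\bigr]_+ ,\qquad u\in\mathbb R^n,\ y\in\mathcal Y .$$ Let $\psi_k:\mathbb R^n\to\mathcal R_k$ be an argmax link, i.e. any map with $\psi_k(u)\in\arg\max_{S\in\mathcal R_k}\sum_{i\in S}u_i$ for all $u$ (ties broken arbitrarily). Put $$\mathcal P^{(3)}=\Bigl\{p\in\Delta_{\mathcal Y}\ :\ p_{[k]}>\tfrac1{k+1}\ \text{ and }\ \tfrac{\sum_{i=k+1}^n p_{[i]}}{k-1}\le p_{[k]}\Bigr\},$$ where the second condition is omitted if $k=1$.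 Then $(L_3,\psi_k)$ is consistent (calibrated) with respect to $\ell_k$ on $\mathcal P^{(3)}$: for every $p\in\mathcal P^{(3)}$, $$\inf_{u\in\mathbb R^n:\ \psi_k(u)\notin\gamma_k(p)}\ \mathbb E_{Y\sim p}L_3(u,Y)\;>\;\inf_{u\in\mathbb R^n}\ \mathbb E_{Y\sim p}L_3(u,Y),$$ where $\gamma_k(p)=\arg\min_{S\in\mathcal R_k}\mathbb E_{Y\sim p}\,\ell_k(S,Y)$ and the infimum over the empty set is $+\infty$. -/

import Mathlib

noncomputable section

namespace TopK

/-- Expected loss `𝔼_{Y ∼ p} L(r, Y)` for a distribution `p` on the labels `Fin n`. -/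
def expectedLoss {n : ℕ} {R : Type*} (L : R → Fin n → ℝ) (p : Fin n → ℝ) (r : R) : ℝ :=
  ∑ y, p y * L r y

/-- The property elicited by `L`: the set of reports minimizing the expected loss under `p`. -/
def prop {n : ℕ} {R : Type*} (L : R → Fin n → ℝ) (p : Fin n → ℝ) : Set R :=
  {r | ∀ r' : R, expectedLoss L p r ≤ expectedLoss L p r'}

/-- `(L, ψ)` is calibrated with respect to `ℓ` over `P`. The infima are taken in the extended
reals, so that the infimum over an empty set of reports is `+∞`. -/
def Calibrated {n d : ℕ} {R : Type*} (L : (Fin d → ℝ) → Fin n → ℝ) (ψ : (Fin d → ℝ) → R)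
    (ℓ : R → Fin n → ℝ) (P : Set (Fin n → ℝ)) : Prop :=
  ∀ p ∈ P,
    (⨅ u : Fin d → ℝ, (expectedLoss L p u : EReal)) <
      ⨅ u ∈ {u : Fin d → ℝ | ψ u ∉ prop ℓ p}, (expectedLoss L p u : EReal)

/-- The reports of top-`k` classification: sets of exactly `k` labels. -/
abbrev Report (n k : ℕ) : Type := {S : Finset (Fin n) // S.card = k}

/-- Top-`k` loss: `1` if the label is not in the reported set and `0` otherwise. -/
def topKLoss {n k : ℕ} (S : Report n k) (y : Fin n) : ℝ :=
  if y ∈ S.1 then 0 else 1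

/-- `T_k(u)`: the size-`k` sets of labels that maximize the sum of the entries of `u`. -/
def topSets {n : ℕ} (k : ℕ) (u : Fin n → ℝ) : Set (Report n k) :=
  {S | ∀ S' : Report n k, ∑ i ∈ S'.1, u i ≤ ∑ i ∈ S.1, u i}

/-- An argmax link: it selects, with arbitrary tie-breaking, a top-`k` set of `u`. -/
def IsArgmaxLink {n k : ℕ} (ψ : (Fin n → ℝ) → Report n k) : Prop :=
  ∀ u, ψ u ∈ topSets k u

/-- The entries of `u` in decreasing order; `sortedDesc u i` is the `(i+1)`-st largest entry
`u_[i+1]`, as `i : Fin n` counts from `0`. -/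
def sortedDesc {n : ℕ} (u : Fin n → ℝ) (i : Fin n) : ℝ :=
  u (Tuple.sort (fun j => -u j) i)

/-- The surrogate `L₃(u, y) = (1/k) ∑_{i=1}^k [1 - u_y + (u - e_y)_[i]]_+`. -/
def L3 {n : ℕ} (k : ℕ) (u : Fin n → ℝ) (y : Fin n) : ℝ :=
  (1 / (k : ℝ)) * ∑ i ∈ Finset.univ.filter (fun i : Fin n => (i : ℕ) < k),
    max (1 - u y + sortedDesc (u - Pi.single y 1) i) 0

/-- The distributions `p` on `n` labels with `p_[k] > 1/(k+1)` and, where the quotient makes sense,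
`(∑_{i=k+1}^n p_[i]) / (k-1) ≤ p_[k]`. -/
def P3 (n k : ℕ) (hk : 1 ≤ k) (hkn : k ≤ n) : Set (Fin n → ℝ) :=
  {p | p ∈ stdSimplex ℝ (Fin n) ∧
    1 / ((k : ℝ) + 1) < sortedDesc p ⟨k - 1, by omega⟩ ∧
    (2 ≤ k →
      (∑ i ∈ Finset.univ.filter (fun i : Fin n => k ≤ (i : ℕ)), sortedDesc p i) / ((k : ℝ) - 1)
        ≤ sortedDesc p ⟨k - 1, by omega⟩)}

end TopK

end

namespace TopK

open Finset

/-! The number `k * L3 k u y` is the maximum of `∑ j ∈ S, (1 + u j - u y)` over sets `S` of at most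
`k` labels other than `y`. Let `T` consist of `k` most probable labels, all of probability at least
`q > 1/(k+1)`; it is top-`k` optimal. A link value that is not optimal differs from `T`, so some `j
∉ T` scores at least as high as some label of `T`. Raise by `1/2` the set `A` of labels of `T`
within `1/2` of the minimum on `T`. Then `k * L3` grows by at most `|A|/2` at labels outside `A` and
drops by at least `(k+1-|A|)/2` on `A`. In expectation the change is at most `|A| (1 - (k+1)q)/2 <
0`, so the excess over the infimum is bounded below uniformly in `u`. -/

/-- An antitone nonnegative sequence has its largest sums over at most `k` indices on the first
`k` indices. -/
theorem sum_le_sum_initial {n k : ℕ} (hkn : k ≤ n) (f : Fin n → ℝ) (hf : Antitone f)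
    (h0 : ∀ i, 0 ≤ f i) (S : Finset (Fin n)) (hS : S.card ≤ k) :
    ∑ i ∈ S, f i ≤ ∑ i ∈ univ.filter (fun i : Fin n => (i : ℕ) < k), f i := by
  rcases Nat.eq_zero_or_pos k with rfl | hk
  · have : S = ∅ := card_eq_zero.mp (Nat.le_zero.mp hS)
    subst this
    exact sum_nonneg fun i _ => h0 i
  set F := univ.filter (fun i : Fin n => (i : ℕ) < k) with hF
  have hFc : F.card = k := by
    rw [hF, Fin.card_filter_val_lt]; omega
  have hcard : (S \ F).card ≤ (F \ S).card := by
    have h1 := card_sdiff_add_card_inter S F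
    have h2 := card_sdiff_add_card_inter F S
    rw [inter_comm] at h2
    omega
  have h1 : ∑ i ∈ S \ F, f i ≤ (S \ F).card • f ⟨k - 1, by omega⟩ := by
    refine sum_le_card_nsmul _ _ _ fun i hi => hf ?_
    have : ¬ (i : ℕ) < k := by simpa [hF] using (mem_sdiff.mp hi).2
    exact Fin.le_def.mpr (by simp only; omega)
  have h2 : (F \ S).card • f ⟨k - 1, by omega⟩ ≤ ∑ i ∈ F \ S, f i := by
    refine card_nsmul_le_sum _ _ _ fun i hi => hf ?_
    have : (i : ℕ) < k := by simpa [hF] using (mem_sdiff.mp hi).1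
    exact Fin.le_def.mpr (by simp only; omega)
  have h3 : (S \ F).card • f ⟨k - 1, by omega⟩ ≤ (F \ S).card • f ⟨k - 1, by omega⟩ :=
    nsmul_le_nsmul_left (h0 _) hcard
  have h4 := sum_inter_add_sum_sdiff S F f
  have h5 := sum_inter_add_sum_sdiff F S f
  rw [inter_comm] at h5
  linarith

theorem antitone_sortedDesc {n : ℕ} (u : Fin n → ℝ) : Antitone (sortedDesc u) := by
  intro i j hij
  have := Tuple.monotone_sort (fun j => -u j) hij
  simpa [sortedDesc] using this

theorem mul_L3 {n k : ℕ} (hk : 1 ≤ k) (u : Fin n → ℝ) (y : Fin n) :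
    (k : ℝ) * L3 k u y = ∑ i ∈ univ.filter (fun i : Fin n => (i : ℕ) < k),
      max (1 - u y + sortedDesc (u - Pi.single y 1) i) 0 := by
  have : (k : ℝ) ≠ 0 := by positivity
  rw [L3, ← mul_assoc, mul_one_div_cancel this, one_mul]

/-- `k L₃(u, y)` dominates the margin sums over at most `k` labels other than `y`. -/
theorem sum_margin_le_mul_L3 {n k : ℕ} (hk : 1 ≤ k) (hkn : k ≤ n) (u : Fin n → ℝ) (y : Fin n)
    (S : Finset (Fin n)) (hy : y ∉ S) (hS : S.card ≤ k) :
    ∑ j ∈ S, (1 + u j - u y) ≤ k * L3 k u y := by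
  rw [mul_L3 hk]
  set w := u - Pi.single y (1 : ℝ) with hw
  set σ := Tuple.sort (fun j => -w j) with hσ
  calc ∑ j ∈ S, (1 + u j - u y) ≤ ∑ j ∈ S, max (1 - u y + w j) 0 := by
        refine sum_le_sum fun j hj => le_max_of_le_left ?_
        have hne : j ≠ y := fun h => hy (h ▸ hj)
        simp only [hw, Pi.sub_apply, Pi.single_eq_of_ne hne]
        linarith
    _ = ∑ i ∈ S.map σ.symm.toEmbedding, max (1 - u y + sortedDesc w i) 0 := by
        simp [sum_map, sortedDesc, ← hσ]
    _ ≤ _ := by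
        refine sum_le_sum_initial hkn (fun i => max (1 - u y + sortedDesc w i) 0) ?_ ?_ _ ?_
        · intro i j hij
          exact max_le_max_right _ (add_le_add_right (antitone_sortedDesc w hij) _)
        · exact fun i => le_max_right _ _
        · simpa using hS

/-- `k L₃(u, y)` is attained as a margin sum over at most `k` labels other than `y`. -/
theorem exists_mul_L3_eq_sum_margin {n k : ℕ} (hk : 1 ≤ k) (u : Fin n → ℝ) (y : Fin n) :
    ∃ S : Finset (Fin n), y ∉ S ∧ S.card ≤ k ∧ k * L3 k u y = ∑ j ∈ S, (1 + u j - u y) := by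
  rw [mul_L3 hk]
  set w := u - Pi.single y (1 : ℝ) with hw
  set σ := Tuple.sort (fun j => -w j) with hσ
  set G := (univ.filter (fun i : Fin n => (i : ℕ) < k)).filter
    (fun i => 0 ≤ 1 - u y + sortedDesc w i) with hG
  refine ⟨(G.map σ.toEmbedding).erase y, by simp, ?_, ?_⟩
  · refine (card_erase_le).trans ?_
    rw [card_map]
    refine (card_filter_le _ _).trans ?_
    rw [Fin.card_filter_val_lt]
    exact min_le_right _ _
  · have hval : ∀ j ∈ (G.map σ.toEmbedding).erase y, 1 + u j - u y = 1 - u y + w j := by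
      intro j hj
      simp only [hw, Pi.sub_apply, Pi.single_eq_of_ne (ne_of_mem_erase hj)]
      ring
    -- Dropping `y` is free: its term is `1 - u y + (u y - 1) = 0`.
    rw [sum_congr rfl hval, sum_erase _ (by simp [hw]), sum_map, hG,
      sum_filter (fun i => 0 ≤ 1 - u y + sortedDesc w i)]
    refine sum_congr rfl fun i _ => ?_
    split_ifs with h
    · rw [max_eq_left h]; rfl
    · exact max_eq_right (not_le.mp h).le

theorem L3_nonneg {n : ℕ} (k : ℕ) (u : Fin n → ℝ) (y : Fin n) : 0 ≤ L3 k u y :=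
  mul_nonneg (by positivity) (sum_nonneg fun _ _ => le_max_right _ _)

/-! ### Effect of raising a set of scores -/

/-- The score obtained from `u` by raising the entries in `A` by `1/2`. -/
noncomputable def raise {n : ℕ} (A : Finset (Fin n)) (u : Fin n → ℝ) (j : Fin n) : ℝ :=
  u j + if j ∈ A then 1 / 2 else 0

theorem sum_margin_raise {n : ℕ} (A : Finset (Fin n)) (u : Fin n → ℝ) (y : Fin n)
    (S : Finset (Fin n)) :
    ∑ j ∈ S, (1 + raise A u j - raise A u y) = ∑ j ∈ S, (1 + u j - u y) +
      (S ∩ A).card * (1 / 2) - S.card * (if y ∈ A then 1 / 2 else 0) := by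
  have h : ∑ j ∈ S, (if j ∈ A then (1 / 2 : ℝ) else 0) = (S ∩ A).card * (1 / 2) := by
    rw [← sum_filter, filter_mem_eq_inter, sum_const, nsmul_eq_mul]
  rw [← h, ← nsmul_eq_mul, ← sum_const, ← sum_add_distrib, ← sum_sub_distrib]
  refine sum_congr rfl fun j _ => ?_
  simp only [raise]
  ring

theorem mul_L3_raise_of_notMem {n k : ℕ} (hk : 1 ≤ k) (hkn : k ≤ n) (A : Finset (Fin n))
    (u : Fin n → ℝ) (y : Fin n) (hy : y ∉ A) :
    k * L3 k (raise A u) y ≤ k * L3 k u y + A.card * (1 / 2) := by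
  obtain ⟨S, hyS, hS, h⟩ := exists_mul_L3_eq_sum_margin hk (raise A u) y
  have h1 := sum_margin_le_mul_L3 hk hkn u y S hyS hS
  have h2 : ((S ∩ A).card : ℝ) ≤ A.card := by exact_mod_cast card_le_card inter_subset_right
  rw [h, sum_margin_raise, if_neg hy]
  linarith

/-- If `k` labels other than `y ∈ A` have margin at least `1/2` against `y`, raising `A` lowers
the loss at `y`. -/
theorem mul_L3_raise_of_mem {n k : ℕ} (hk : 1 ≤ k) (hkn : k ≤ n) (A : Finset (Fin n))
    (u : Fin n → ℝ) (y : Fin n) (hy : y ∈ A) (W : Finset (Fin n)) (hyW : y ∉ W)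
    (hW : W.card = k) (hmargin : ∀ j ∈ W, 1 / 2 ≤ 1 + u j - u y) :
    k * L3 k (raise A u) y ≤ k * L3 k u y + (A.card - (k + 1)) * (1 / 2) := by
  obtain ⟨S, hyS, hS, h⟩ := exists_mul_L3_eq_sum_margin hk (raise A u) y
  -- Padding `S` to size `k` from `W` adds at least `1/2` per label, so a small `S` is far from
  -- optimal for `u`.
  obtain ⟨S', hSS', hS'W, hS'⟩ := exists_subsuperset_card_eq (subset_union_left : S ⊆ S ∪ W) hS
    (hW ▸ card_le_card subset_union_right)
  have hyS' : y ∉ S' := fun hmem => by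
    rcases mem_union.mp (hS'W hmem) with h | h
    · exact hyS h
    · exact hyW h
  have h1 := sum_margin_le_mul_L3 hk hkn u y S' hyS' hS'.le
  -- `y` lies in `A` but not in `S`; this gives the `+ 1` in `k + 1`.
  have h2 : (S ∩ A).card + 1 ≤ A.card := by
    refine Nat.succ_le_of_lt (card_lt_card ⟨inter_subset_right, fun hsub => ?_⟩)
    exact hyS (mem_inter.mp (hsub hy)).1
  have h2' : ((S ∩ A).card : ℝ) + 1 ≤ A.card := by exact_mod_cast h2
  have h3 := sum_sdiff (f := fun j => 1 + u j - u y) hSS'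
  have h4 : (S' \ S).card • (1 / 2 : ℝ) ≤ ∑ j ∈ S' \ S, (1 + u j - u y) := by
    refine card_nsmul_le_sum _ _ _ fun j hj => hmargin j ?_
    obtain ⟨hj1, hj2⟩ := mem_sdiff.mp hj
    exact (mem_union.mp (hS'W hj1)).resolve_left hj2
  have h5 : ((S' \ S).card : ℝ) + S.card = k := by
    exact_mod_cast (card_sdiff_add_card_eq_card hSS').trans hS'
  rw [nsmul_eq_mul] at h4
  rw [h, sum_margin_raise, if_pos hy]
  linarith

/-- If a label outside `T` scores at least as high as some label of `T`, and every label of `T` has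
probability at least `q > 1/(k+1)`, then the expected loss can be lowered by an amount depending
only on `q` and `k`. -/
theorem exists_expectedLoss_L3_add_le {n k : ℕ} (hk : 1 ≤ k) (hkn : k ≤ n) (p : Fin n → ℝ)
    (hp : p ∈ stdSimplex ℝ (Fin n)) (q : ℝ) (hq : 1 / ((k : ℝ) + 1) < q) (T : Finset (Fin n))
    (hT : T.card = k) (hTq : ∀ i ∈ T, q ≤ p i) (u : Fin n → ℝ) (i j : Fin n) (hi : i ∈ T)
    (hj : j ∉ T) (hij : u i ≤ u j) :
    ∃ u', expectedLoss (L3 k) p u' + ((k + 1) * q - 1) / (2 * k) ≤ expectedLoss (L3 k) p u := by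
  have hk0 : (0 : ℝ) < k := by exact_mod_cast hk
  obtain ⟨i₀, hi₀, hmin⟩ := exists_min_image T u ⟨i, hi⟩
  set A := T.filter (fun y => u y ≤ u i₀ + 1 / 2) with hA
  have hi₀A : i₀ ∈ A := mem_filter.mpr ⟨hi₀, by linarith⟩
  refine ⟨raise A u, ?_⟩
  have hstep : ∀ y, k * L3 k (raise A u) y ≤
      k * L3 k u y + (A.card - if y ∈ A then (k + 1 : ℝ) else 0) * (1 / 2) := by
    intro y
    split_ifs with hy
    · obtain ⟨hyT, hyu⟩ := mem_filter.mp hy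
      -- Labels of `T`, and also `j`, score at least `u i₀ ≥ u y - 1/2`.
      refine mul_L3_raise_of_mem hk hkn A u y hy (insert j (T.erase y)) ?_ ?_ ?_
      · simp only [mem_insert, mem_erase, ne_eq, not_true_eq_false, false_and, or_false]
        rintro rfl
        exact hj hyT
      · rw [card_insert_of_notMem fun h => hj (mem_of_mem_erase h), card_erase_of_mem hyT, hT]
        omega
      · intro l hl
        rcases mem_insert.mp hl with rfl | hl
        · linarith [hmin i hi]
        · linarith [hmin l (mem_of_mem_erase hl)]
    · simpa using mul_L3_raise_of_notMem hk hkn A u y hy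
  have hsum : ∑ y, p y * (k * L3 k (raise A u) y) ≤ ∑ y, p y * (k * L3 k u y +
      (A.card - if y ∈ A then (k + 1 : ℝ) else 0) * (1 / 2)) :=
    sum_le_sum fun y _ => mul_le_mul_of_nonneg_left (hstep y) (hp.1 y)
  have hleft : ∀ v, ∑ y, p y * (k * L3 k v y) = k * expectedLoss (L3 k) p v := by
    intro v
    rw [expectedLoss, mul_sum]
    exact sum_congr rfl fun y _ => by ring
  have hright : ∑ y, p y * (k * L3 k u y +
      (A.card - if y ∈ A then (k + 1 : ℝ) else 0) * (1 / 2)) =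
      k * expectedLoss (L3 k) p u + (A.card - (k + 1) * ∑ y ∈ A, p y) * (1 / 2) := by
    have h1 : ∑ y, p y * (if y ∈ A then (k + 1 : ℝ) else 0) = (k + 1) * ∑ y ∈ A, p y := by
      simp only [mul_ite, mul_zero, sum_ite_mem, univ_inter]
      rw [mul_sum]
      exact sum_congr rfl fun y _ => by ring
    have h2 : ∑ y, p y * (A.card : ℝ) = A.card := by rw [← sum_mul, hp.2, one_mul]
    rw [← hleft, ← h1]
    conv_rhs => rw [← h2]
    rw [← sum_sub_distrib, sum_mul, ← sum_add_distrib]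
    exact sum_congr rfl fun y _ => by ring
  rw [hleft, hright] at hsum
  have hpA : A.card • q ≤ ∑ y ∈ A, p y :=
    card_nsmul_le_sum _ _ _ fun y hy => hTq y (mem_filter.mp hy).1
  rw [nsmul_eq_mul] at hpA
  have hA1 : (1 : ℝ) ≤ A.card := by exact_mod_cast card_pos.mpr ⟨i₀, hi₀A⟩
  have hgap : 0 < (k + 1) * q - 1 := by
    rw [div_lt_iff₀ (by positivity)] at hq
    linarith
  have h1 : (k + 1) * (A.card * q) ≤ (k + 1) * ∑ y ∈ A, p y :=
    mul_le_mul_of_nonneg_left hpA (by positivity)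
  have h2 : (k + 1) * q - 1 ≤ A.card * ((k + 1) * q - 1) := le_mul_of_one_le_left hgap.le hA1
  have h3 : k * (((k + 1) * q - 1) / (2 * k)) = ((k + 1) * q - 1) / 2 := by
    field_simp
  refine le_of_mul_le_mul_left ?_ hk0
  rw [mul_add, h3]
  linarith

/-! ### Optimal reports and the argmax link -/

theorem expectedLoss_topKLoss {n k : ℕ} (p : Fin n → ℝ) (S : Report n k) :
    expectedLoss topKLoss p S = ∑ y, p y - ∑ y ∈ S.1, p y := by
  rw [← sum_compl_add_sum S.1 p, add_sub_cancel_right]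
  rw [compl_eq_univ_sdiff, ← filter_notMem_eq_sdiff, sum_filter]
  exact sum_congr rfl fun y _ => by by_cases h : y ∈ S.1 <;> simp [topKLoss, h]

/-- A set of `k` labels of probability greater than `1/(k+1)` is optimal for the top-`k` loss. -/
theorem mem_prop_topKLoss {n k : ℕ} (p : Fin n → ℝ) (hp : p ∈ stdSimplex ℝ (Fin n)) (q : ℝ)
    (hq : 1 / ((k : ℝ) + 1) < q) (T : Report n k) (hTq : ∀ i ∈ T.1, q ≤ p i) :
    T ∈ prop topKLoss p := by
  intro S
  rw [expectedLoss_topKLoss, expectedLoss_topKLoss]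
  refine sub_le_sub_left ?_ _
  by_cases hsub : T.1 ⊆ S.1
  · rw [eq_of_subset_of_card_le hsub (by rw [S.2, T.2])]
  · obtain ⟨i, hiT, hiS⟩ := not_subset.mp hsub
    -- `S` misses mass at least `q`, so its mass is at most `1 - q < k q`, which `T` attains.
    have h1 : ∑ y ∈ insert i S.1, p y ≤ ∑ y, p y :=
      sum_le_sum_of_subset_of_nonneg (subset_univ _) fun y _ _ => hp.1 y
    rw [sum_insert hiS, hp.2] at h1
    have h2 : T.1.card • q ≤ ∑ y ∈ T.1, p y := card_nsmul_le_sum _ _ _ hTq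
    rw [T.2, nsmul_eq_mul] at h2
    rw [div_lt_iff₀ (by positivity)] at hq
    linarith [hTq i hiT]

/-- The `k` first labels in the order of decreasing probability. -/
theorem exists_top_report {n k : ℕ} (hk : 1 ≤ k) (hkn : k ≤ n) (p : Fin n → ℝ) :
    ∃ T : Report n k, ∀ i ∈ T.1, sortedDesc p ⟨k - 1, by omega⟩ ≤ p i := by
  refine ⟨⟨(univ.filter (fun i : Fin n => (i : ℕ) < k)).map
    (Tuple.sort (fun j => -p j)).toEmbedding, ?_⟩, ?_⟩
  · rw [card_map, Fin.card_filter_val_lt]; omega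
  · intro i hi
    obtain ⟨l, hl, rfl⟩ := mem_map.mp hi
    refine antitone_sortedDesc p (Fin.le_def.mpr ?_)
    have : (l : ℕ) < k := (mem_filter.mp hl).2
    simp only
    omega

/-- A top set of `u` other than `T` contains a label outside `T` scoring at least as high as some
label of `T`. -/
theorem exists_inversion_of_mem_topSets {n k : ℕ} (u : Fin n → ℝ) (S T : Report n k)
    (hS : S ∈ topSets k u) (hne : S ≠ T) : ∃ i ∈ T.1, ∃ j ∉ T.1, u i ≤ u j := by
  obtain ⟨i, hiT, hiS⟩ := not_subset.mp fun h : T.1 ⊆ S.1 =>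
    hne (Subtype.ext (eq_of_subset_of_card_le h (by rw [S.2, T.2])).symm)
  obtain ⟨j, hjS, hjT⟩ := not_subset.mp fun h : S.1 ⊆ T.1 =>
    hne (Subtype.ext (eq_of_subset_of_card_le h (by rw [S.2, T.2])))
  refine ⟨i, hiT, j, hjT, ?_⟩
  have hi' : i ∉ S.1.erase j := fun h => hiS (mem_of_mem_erase h)
  have hc : (insert i (S.1.erase j)).card = k := by
    rw [card_insert_of_notMem hi', card_erase_add_one hjS, S.2]
  have h := hS ⟨_, hc⟩
  rw [sum_insert hi', ← add_sum_erase S.1 u hjS] at h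
  linarith

end TopK

theorem mainTheorem4 (n k : ℕ) (hk : 1 ≤ k) (hkn : k ≤ n)
    (ψ : (Fin n → ℝ) → TopK.Report n k) (hψ : TopK.IsArgmaxLink ψ) :
    TopK.Calibrated (TopK.L3 k) ψ TopK.topKLoss (TopK.P3 n k hk hkn) := by
  rintro p ⟨hp, hq, -⟩
  set q := TopK.sortedDesc p ⟨k - 1, by omega⟩
  obtain ⟨T, hT⟩ := TopK.exists_top_report hk hkn p
  have hTprop := TopK.mem_prop_topKLoss p hp q hq T hT
  set δ : ℝ := ((k + 1) * q - 1) / (2 * k)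
  have hδ0 : 0 < δ := by
    have hk0 : (0 : ℝ) < k := by exact_mod_cast hk
    rw [div_lt_iff₀ (by positivity)] at hq
    exact div_pos (by linarith) (by positivity)
  set I : EReal := ⨅ u : Fin n → ℝ, (TopK.expectedLoss (TopK.L3 k) p u : EReal) with hI
  have hbot : I ≠ ⊥ := by
    have : (0 : EReal) ≤ I := le_iInf fun u => EReal.coe_nonneg.mpr <|
      Finset.sum_nonneg fun y _ => mul_nonneg (hp.1 y) (TopK.L3_nonneg k u y)
    exact (lt_of_lt_of_le EReal.bot_lt_zero this).ne'
  have htop : I ≠ ⊤ :=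
    ((iInf_le (fun u => (TopK.expectedLoss (TopK.L3 k) p u : EReal)) 0).trans_lt (EReal.coe_lt_top _)).ne
  -- Finiteness of the infimum makes adding `δ` a strict increase.
  lift I to ℝ using ⟨htop, hbot⟩ with r hr
  have hle : ∀ u, r ≤ TopK.expectedLoss (TopK.L3 k) p u := fun u =>
    EReal.coe_le_coe_iff.mp (hI.le.trans (iInf_le _ u))
  refine lt_of_lt_of_le (EReal.coe_lt_coe_iff.mpr (lt_add_of_pos_right r hδ0)) ?_
  refine le_iInf₂ fun u hu => EReal.coe_le_coe_iff.mpr ?_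
  obtain ⟨i, hi, j, hj, hij⟩ := TopK.exists_inversion_of_mem_topSets u (ψ u) T (hψ u)
    fun h => hu (h ▸ hTprop)
  obtain ⟨u', hu'⟩ := TopK.exists_expectedLoss_L3_add_le hk hkn p hp q hq T.1 T.2 hT u i j hi hj hij
  linarith [hle u']
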